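/- Let $0<\alpha<1$ and $c>0$. There is a constant $C(\alpha,c)>0$, depending only on $\alpha$ and $c$, with the following property. Let $A$ be a self-adjoint positive-definite (possibly unbounded) linear operator in a real Hilbert space $H$ with norm $\|\cdot\|$, let $\beta(t)=t^{\alpha-1}/\Gamma(\alpha)$ be the Abel kernel, let $f$ be an $H$-valued function on $(0,\infty)$ that is integrable on $(0,T)$ for every $T>0$, and let $u:[0,\infty)\to D(A)$ be a solution, continuous in $H$ on $[0,\infty)$ and differentiable for $t>0$, of $$u_t(t)+Au(t)+\int_0^t\beta(t-s)\,Au(s)\,ds=f(t)\quad(t>0),\qquad u(0)=u_0 .$$ Suppose that $u$ is twice differentiable on $(0,\infty)$, that $u_t(t),u_{tt}(t)\in D(A)$ for $t>0$, and that for some $M\ge 0$ $$t\,\|Au_t(t)\|+t^2\,\|Au_{tt}(t)\|\le M\,t^{\alpha+1}\qquad\text{for all } t>0 .$$ Let $k>0$ be a step size such that $k^\alpha\le \dfrac{s_0\,\Gamma(\alpha+2)}{s_0+C_\alpha}$ for some $s_0>0$ and $C_\alpha>0$, and put $t_n=nk$. Let $U^n\in D(A)$, $n\ge 0$, be a solution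 of the Crank–Nicolson scheme $$\frac{U^n-U^{n-1}}{k}+A\,\frac{U^n+U^{n-1}}{2}+Q_{n-\frac12}(AU)=\frac1k\int_{t_{n-1}}^{t_n}f(t)\,dt\quad(n\ge1),\qquad U^0=u_0,$$ with the product-integration rule $$Q_{n-\frac12}(\varphi)=\frac{w_{n-1}(\varphi^1-\varphi^0)}{2}+\sum_{p=1}^{n}w_{n-p}\,\frac{\varphi^p+\varphi^{p-1}}{2},$$ $$w_0=\frac{k^\alpha}{\Gamma(\alpha+2)},\qquad w_j=\frac{t_{j+1}^{\alpha+1}-2t_j^{\alpha+1}+t_{j-1}^{\alpha+1}}{k\,\Gamma(\alpha+2)}\quad(j\ge1).$$ Then the series below converges and $$\Big(\sum_{n=0}^{\infty}e^{-cn}\,\|U^n-u(t_n)\|^2\Big)^{1/2}\le C(\alpha,c)\,M\,k^2 .$$ -/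

import Mathlib

open MeasureTheory Set
open scoped RealInnerProductSpace

noncomputable section

namespace VolterraCN

/-- `A` is a self-adjoint, positive-definite (in general unbounded) operator on `H`.
Mathlib's self-adjointness of a partially defined operator is `A† = A` and includes
density of the domain. -/
structure IsSelfAdjointPosDef {H : Type*} [NormedAddCommGroup H] [InnerProductSpace ℝ H]
    [CompleteSpace H] (A : H →ₗ.[ℝ] H) : Prop where
  selfAdjoint : IsSelfAdjoint A
  posDef : ∀ v : A.domain, (v : H) ≠ 0 → 0 < ⟪A v, (v : H)⟫

/-- The Abel kernel `β(t) = t ^ (α - 1) / Γ(α)`. -/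
def abelKernel (α t : ℝ) : ℝ := t ^ (α - 1) / Real.Gamma α

/-- `u` solves `u' + A u + β * A u = f` for `t > 0`, `u(0) = u₀`, with the Abel kernel `β`.
Only the values of `u` on `[0, ∞)` and of `f` on `(0, ∞)` matter. -/
structure IsSolution {H : Type*} [NormedAddCommGroup H] [InnerProductSpace ℝ H]
    (A : H →ₗ.[ℝ] H) (α : ℝ) (f : ℝ → H) (u₀ : H) (u : ℝ → A.domain) : Prop where
  initial : (u 0 : H) = u₀
  continuousOn : ContinuousOn (fun t => (u t : H)) (Ici 0)
  convolution_integrable : ∀ t : ℝ, 0 < t →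
    IntervalIntegrable (fun s => abelKernel α (t - s) • A (u s)) volume 0 t
  equation : ∀ t : ℝ, 0 < t → ∃ v : H, HasDerivAt (fun t => (u t : H)) v t ∧
    v + A (u t) + (∫ s in (0 : ℝ)..t, abelKernel α (t - s) • A (u s)) = f t

/-- The regularity bound `t ‖A u_t‖ + t² ‖A u_tt‖ ≤ M t ^ (α + 1)` for all `t > 0`; it includes
that `u_t` and `u_tt` exist and take values in the domain of `A`. -/
def RegularityBound {H : Type*} [NormedAddCommGroup H] [InnerProductSpace ℝ H]
    (A : H →ₗ.[ℝ] H) (α M : ℝ) (u : ℝ → A.domain) : Prop :=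
  ∃ ut utt : ℝ → A.domain, ∀ t : ℝ, 0 < t →
    HasDerivAt (fun s => (u s : H)) (ut t : H) t ∧
    HasDerivAt (fun s => (ut s : H)) (utt t : H) t ∧
    t * ‖A (ut t)‖ + t ^ 2 * ‖A (utt t)‖ ≤ M * t ^ (α + 1)

/-- The weights `w_j` of the product-integration rule with step `k`, where `t_j = j k`. -/
def piWeight (α k : ℝ) (j : ℕ) : ℝ :=
  if j = 0 then k ^ α / Real.Gamma (α + 2)
  else ((((j : ℝ) + 1) * k) ^ (α + 1) - 2 * ((j : ℝ) * k) ^ (α + 1)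
      + (((j : ℝ) - 1) * k) ^ (α + 1)) / (k * Real.Gamma (α + 2))

/-- The average `φ^{n - 1/2} = (φ^n + φ^{n-1}) / 2`, for `n ≥ 1`. -/
def halfStep {H : Type*} [NormedAddCommGroup H] [InnerProductSpace ℝ H]
    (φ : ℕ → H) (n : ℕ) : H :=
  (1 / 2 : ℝ) • (φ n + φ (n - 1))

/-- The product-integration rule
`Q_{n-1/2}(φ) = w_{n-1} (φ^1 - φ^0) / 2 + ∑_{p=1}^n w_{n-p} φ^{p-1/2}`, for `n ≥ 1`. -/
def piRule {H : Type*} [NormedAddCommGroup H] [InnerProductSpace ℝ H]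
    (α k : ℝ) (φ : ℕ → H) (n : ℕ) : H :=
  (piWeight α k (n - 1) / 2) • (φ 1 - φ 0)
    + ∑ p ∈ Finset.Icc 1 n, piWeight α k (n - p) • halfStep φ p

/-- `U` satisfies the Crank–Nicolson scheme with the product-integration rule:
`(U^n - U^{n-1}) / k + A U^{n-1/2} + Q_{n-1/2}(A U) = (1/k) ∫_{t_{n-1}}^{t_n} f` for `n ≥ 1`,
and `U^0 = u₀`. -/
structure IsSchemeSolution {H : Type*} [NormedAddCommGroup H] [InnerProductSpace ℝ H]
    (A : H →ₗ.[ℝ] H) (α k : ℝ) (f : ℝ → H) (u₀ : H) (U : ℕ → A.domain) : Prop where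
  initial : (U 0 : H) = u₀
  step : ∀ n : ℕ, 1 ≤ n →
    (1 / k) • ((U n : H) - (U (n - 1) : H)) + halfStep (fun m => A (U m)) n
        + piRule α k (fun m => A (U m)) n
      = (1 / k) • ∫ t in (((n : ℝ) - 1) * k)..((n : ℝ) * k), f t

end VolterraCN

end

/-! The factor `exp (-c * n)` absorbs any power of `n`, so a pointwise bound on the error by a
constant times `M k² n⁵` (`norm_error_le`) is enough.

The factor `k²` does not come from quadrature of second order. Since `‖A u_t‖ ≤ M t ^ α`, `A u`
varies on `[0, t_n]` by at most `M t_n ^ (α + 1)`. Replacing it by a constant in one step, where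
rule and integral agree, costs `k t_n ^ (α + 1)` times `M` and a polynomial in `n`. As `t_n = n k`
and `k ^ α ≤ Γ(α + 2)`, this is `M k²` times a polynomial in `n` (`norm_defect_le`).

Stability is an energy argument (`norm_le_of_scheme`): test each step with the midpoint of the error
and sum. The memory term has the right sign because the weights, with the diagonal one doubled, form
a nonnegative, nonincreasing, convex sequence, and such Toeplitz kernels are nonnegative
combinations of Fejér kernels (`toeplitz_form_nonneg`). The starting correction is not a
convolution; it is moved to the forcing and controlled by the first step alone. -/

namespace VolterraCN

/-! ### Toeplitz forms with convex kernels -/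

/-- The Fejér kernel `(m - |n - p|)₊` counts the windows of length `m` containing `n` and `p`. -/
lemma fejer_eq_sum_indicator (N m n p : ℕ) (hn : n < N) :
    (((m - Nat.dist n p : ℕ) : ℝ)) = ∑ i ∈ Finset.range (N + m),
      (if n ≤ i ∧ i < n + m then (1 : ℝ) else 0) * (if p ≤ i ∧ i < p + m then 1 else 0) := by
  have h1 : ∀ i, (if n ≤ i ∧ i < n + m then (1 : ℝ) else 0) *
      (if p ≤ i ∧ i < p + m then 1 else 0) =
      if i ∈ Finset.Ico (max n p) (min n p + m) then 1 else 0 := by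
    intro i
    simp only [Finset.mem_Ico, mul_ite, mul_one, mul_zero]
    split_ifs <;> first | rfl | omega
  simp_rw [h1]
  rw [Finset.sum_ite_mem, Finset.sum_const, nsmul_eq_mul, mul_one]
  -- Since `n < N`, the intersection of the two windows ends before `N + m`, so the range cuts
  -- nothing off.
  have h2 : Finset.range (N + m) ∩ Finset.Ico (max n p) (min n p + m) =
      Finset.Ico (max n p) (min n p + m) := by
    apply Finset.inter_eq_right.2
    intro i hi
    simp only [Finset.mem_Ico, Finset.mem_range] at *
    omega
  rw [h2, Nat.card_Ico, Nat.dist]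
  congr 1
  omega

/-- Counting windows splits the form into one unweighted sum of `G` for each `i`, over the indices
whose window contains `i`. This is why `hG` is asked for every finite set. -/
lemma fejer_form_nonneg {G : ℕ → ℕ → ℝ}
    (hG : ∀ s : Finset ℕ, 0 ≤ ∑ n ∈ s, ∑ p ∈ s, G n p) (N m : ℕ) :
    0 ≤ ∑ n ∈ Finset.range N, ∑ p ∈ Finset.range N, ((m - Nat.dist n p : ℕ) : ℝ) * G n p := by
  have h : ∑ n ∈ Finset.range N, ∑ p ∈ Finset.range N, ((m - Nat.dist n p : ℕ) : ℝ) * G n p =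
      ∑ i ∈ Finset.range (N + m),
        ∑ n ∈ (Finset.range N).filter (fun n => n ≤ i ∧ i < n + m),
          ∑ p ∈ (Finset.range N).filter (fun p => p ≤ i ∧ i < p + m), G n p := by
    simp_rw [Finset.sum_filter]
    rw [Finset.sum_comm (s := Finset.range (N + m))]
    refine Finset.sum_congr rfl fun n hn => ?_
    have : ∀ p ∈ Finset.range N, ((m - Nat.dist n p : ℕ) : ℝ) * G n p =
        ∑ i ∈ Finset.range (N + m), if n ≤ i ∧ i < n + m then
          (if p ≤ i ∧ i < p + m then G n p else 0) else 0 := by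
      intro p _
      rw [fejer_eq_sum_indicator N m n p (Finset.mem_range.1 hn), Finset.sum_mul]
      refine Finset.sum_congr rfl fun i _ => ?_
      split_ifs <;> simp
    rw [Finset.sum_congr rfl this, Finset.sum_comm]
    refine Finset.sum_congr rfl fun i _ => ?_
    split_ifs <;> simp
  rw [h]
  exact Finset.sum_nonneg fun i _ => hG _

/-- A sequence is a combination of a constant and Fejér kernels, on a finite range. -/
lemma eq_sum_fejer (c : ℕ → ℝ) (L j : ℕ) (hj : j ≤ L) :
    c j = c L + (c L - c (L + 1)) * ((L - j : ℕ) : ℝ) +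
      ∑ m ∈ Finset.range L, (c m - 2 * c (m + 1) + c (m + 2)) * ((m + 1 - j : ℕ) : ℝ) := by
  induction L with
  | zero =>
    obtain rfl : j = 0 := by omega
    simp
  | succ L ih =>
    rcases Nat.lt_or_ge L j with h | h
    · obtain rfl : j = L + 1 := by omega
      rw [Finset.sum_eq_zero]
      · simp
      · intro m hm
        have : m + 1 - (L + 1) = 0 := by
          have := Finset.mem_range.1 hm
          omega
        simp [this]
    · rw [Finset.sum_range_succ]
      have h0 := ih h
      have e1 : ((L + 1 - j : ℕ) : ℝ) = L + 1 - j := by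
        rw [Nat.cast_sub (by omega)]; push_cast; ring
      have e2 : ((L - j : ℕ) : ℝ) = L - j := by
        rw [Nat.cast_sub (by omega)]
      rw [e1]
      rw [e2] at h0
      rw [show L + 1 + 1 = L + 2 from rfl]
      linear_combination h0

/-- Toeplitz forms with nonnegative, nonincreasing, convex kernels are nonnegative. -/
lemma toeplitz_form_nonneg {G : ℕ → ℕ → ℝ}
    (hG : ∀ s : Finset ℕ, 0 ≤ ∑ n ∈ s, ∑ p ∈ s, G n p) {c : ℕ → ℝ} (h0 : ∀ j, 0 ≤ c j)
    (h1 : ∀ j, c (j + 1) ≤ c j) (h2 : ∀ j, 0 ≤ c j - 2 * c (j + 1) + c (j + 2)) (N : ℕ) :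
    0 ≤ ∑ n ∈ Finset.range N, ∑ p ∈ Finset.range N, c (Nat.dist n p) * G n p := by
  have h : ∑ n ∈ Finset.range N, ∑ p ∈ Finset.range N, c (Nat.dist n p) * G n p =
      c N * (∑ n ∈ Finset.range N, ∑ p ∈ Finset.range N, G n p) +
      (c N - c (N + 1)) * (∑ n ∈ Finset.range N, ∑ p ∈ Finset.range N,
        ((N - Nat.dist n p : ℕ) : ℝ) * G n p) +
      ∑ m ∈ Finset.range N, (c m - 2 * c (m + 1) + c (m + 2)) *
        (∑ n ∈ Finset.range N, ∑ p ∈ Finset.range N,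
          ((m + 1 - Nat.dist n p : ℕ) : ℝ) * G n p) := by
    have e : ∀ n ∈ Finset.range N, ∀ p ∈ Finset.range N, c (Nat.dist n p) * G n p =
        c N * G n p + (c N - c (N + 1)) * (((N - Nat.dist n p : ℕ) : ℝ) * G n p) +
        ∑ m ∈ Finset.range N, (c m - 2 * c (m + 1) + c (m + 2)) *
          (((m + 1 - Nat.dist n p : ℕ) : ℝ) * G n p) := by
      intro n hn p hp
      have hd : Nat.dist n p ≤ N := by
        have := Finset.mem_range.1 hn
        have := Finset.mem_range.1 hp
        unfold Nat.dist
        omega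
      have := eq_sum_fejer c N _ hd
      rw [this, add_mul, add_mul, Finset.sum_mul, mul_assoc]
      simp_rw [mul_assoc]
    rw [Finset.sum_congr rfl fun n hn => Finset.sum_congr rfl (e n hn)]
    simp_rw [Finset.sum_add_distrib, Finset.mul_sum]
    congr 1
    exact (Finset.sum_congr rfl fun n _ => Finset.sum_comm).trans Finset.sum_comm
  rw [h]
  have a1 := mul_nonneg (h0 N) (hG (Finset.range N))
  have a2 := mul_nonneg (sub_nonneg.2 (h1 N)) (fejer_form_nonneg hG N N)
  have a3 : 0 ≤ ∑ m ∈ Finset.range N, (c m - 2 * c (m + 1) + c (m + 2)) *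
        (∑ n ∈ Finset.range N, ∑ p ∈ Finset.range N,
          ((m + 1 - Nat.dist n p : ℕ) : ℝ) * G n p) :=
    Finset.sum_nonneg fun m _ => mul_nonneg (h2 m) (fejer_form_nonneg hG N (m + 1))
  linarith

/-- The causal convolution form with weights `w` is half the symmetric Toeplitz form in which the
diagonal weight is doubled. -/
lemma two_mul_causal_form {G : ℕ → ℕ → ℝ} (hsymm : ∀ n p, G n p = G p n) (w : ℕ → ℝ) (N : ℕ) :
    2 * ∑ n ∈ Finset.range N, ∑ p ∈ Finset.range (n + 1), w (n - p) * G n p =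
      ∑ n ∈ Finset.range N, ∑ p ∈ Finset.range N,
        (if Nat.dist n p = 0 then 2 * w 0 else w (Nat.dist n p)) * G n p := by
  induction N with
  | zero => simp
  | succ N ih =>
    rw [Finset.sum_range_succ, mul_add, ih, Finset.sum_range_succ _ N, Finset.sum_range_succ _ N]
    simp_rw [Finset.sum_range_succ _ N]
    rw [Finset.sum_add_distrib]
    have e1 : ∑ p ∈ Finset.range N, w (N - p) * G N p = ∑ n ∈ Finset.range N,
        (if Nat.dist n N = 0 then 2 * w 0 else w (Nat.dist n N)) * G n N := by
      refine Finset.sum_congr rfl fun n hn => ?_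
      have := Finset.mem_range.1 hn
      rw [Nat.dist_eq_sub_of_le this.le, if_neg (by omega), hsymm]
    have e2 : ∑ p ∈ Finset.range N, w (N - p) * G N p = ∑ p ∈ Finset.range N,
        (if Nat.dist N p = 0 then 2 * w 0 else w (Nat.dist N p)) * G N p := by
      refine Finset.sum_congr rfl fun n hn => ?_
      have := Finset.mem_range.1 hn
      rw [Nat.dist_eq_sub_of_le_right this.le, if_neg (by omega)]
    rw [← e1, ← e2, Nat.dist_self, if_pos rfl, Nat.sub_self]
    ring

/-! ### The weights -/

/-- The weights of the product-integration rule for unit step, up to a constant factor. -/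
noncomputable def unitWeight (α : ℝ) (j : ℕ) : ℝ :=
  if j = 0 then 1 else ((j : ℝ) + 1) ^ (α + 1) - 2 * (j : ℝ) ^ (α + 1) + ((j : ℝ) - 1) ^ (α + 1)

lemma piWeight_eq {α k : ℝ} (hk : 0 < k) (j : ℕ) :
    piWeight α k j = k ^ α / Real.Gamma (α + 2) * unitWeight α j := by
  unfold piWeight unitWeight
  split_ifs with h
  · simp
  · have hj : (1 : ℝ) ≤ j := by exact_mod_cast Nat.one_le_iff_ne_zero.2 h
    rw [Real.mul_rpow (by linarith) hk.le, Real.mul_rpow (by linarith) hk.le,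
      Real.mul_rpow (by linarith) hk.le, Real.rpow_add_one hk.ne']
    field_simp

/-- Second differences telescope to a first difference, which is what integrating `t ^ α` over one
step gives. -/
lemma sum_unitWeight {α : ℝ} (hα : 0 < α) (n : ℕ) :
    ∑ j ∈ Finset.range (n + 1), unitWeight α j = ((n : ℝ) + 1) ^ (α + 1) - (n : ℝ) ^ (α + 1) := by
  induction n with
  | zero => simp [unitWeight, Real.zero_rpow (by linarith : α + 1 ≠ 0)]
  | succ n ih =>
    rw [Finset.sum_range_succ, ih, unitWeight, if_neg (by omega)]
    push_cast
    ring_nf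

/-- The second central difference of `x ^ (α + 1)`. -/
noncomputable def secondDiff (α x : ℝ) : ℝ :=
  (x + 1) ^ (α + 1) - 2 * x ^ (α + 1) + (x - 1) ^ (α + 1)

lemma continuousOn_secondDiff {α : ℝ} (hα : 0 < α) : ContinuousOn (secondDiff α) (Ici 1) := by
  have h : 0 ≤ α + 1 := by linarith
  unfold secondDiff
  exact Continuous.continuousOn (by fun_prop (disch := assumption))

lemma hasDerivAt_secondDiff (α : ℝ) {x : ℝ} (hx : 1 < x) : HasDerivAt (secondDiff α)
    ((α + 1) * ((x + 1) ^ α - 2 * x ^ α + (x - 1) ^ α)) x := by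
  have h1 := ((hasDerivAt_id x).add_const 1).rpow_const (p := α + 1)
    (Or.inl (by simp only [id]; linarith))
  have h2 := (hasDerivAt_id x).rpow_const (p := α + 1) (Or.inl (by simp only [id]; linarith))
  have h3 := ((hasDerivAt_id x).sub_const 1).rpow_const (p := α + 1)
    (Or.inl (by simp only [id]; linarith))
  refine ((h1.sub (h2.const_mul 2)).add h3).congr_deriv ?_
  simp only [id, add_sub_cancel_right]
  ring

/-- By the AM-GM inequality the right side is at least `2 (x² - 1) ^ (q / 2)`, and `x² - 1 ≤ x²`
with `q ≤ 0`. -/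
lemma two_mul_rpow_le_of_nonpos {q x : ℝ} (hq : q ≤ 0) (hx : 1 < x) :
    2 * x ^ q ≤ (x + 1) ^ q + (x - 1) ^ q := by
  have e : ∀ y : ℝ, 0 < y → y ^ q = y ^ (q / 2) * y ^ (q / 2) := fun y hy => by
    rw [← Real.rpow_add hy, add_halves]
  have h : x ^ (q / 2) * x ^ (q / 2) ≤ (x + 1) ^ (q / 2) * (x - 1) ^ (q / 2) := by
    rw [← Real.mul_rpow (by linarith) (by linarith), ← Real.mul_rpow (by linarith) (by linarith)]
    exact Real.rpow_le_rpow_of_nonpos (by nlinarith) (by nlinarith) (by linarith)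
  rw [e x (by linarith), e (x + 1) (by linarith), e (x - 1) (by linarith)]
  nlinarith [sq_nonneg ((x + 1) ^ (q / 2) - (x - 1) ^ (q / 2))]

/-- Differencing commutes with differentiation: the second derivative is a positive multiple of the
second difference of the convex function `x ^ (α - 1)`. -/
lemma convexOn_secondDiff {α : ℝ} (h0 : 0 < α) (h1 : α < 1) :
    ConvexOn ℝ (Ici 1) (secondDiff α) := by
  refine convexOn_of_hasDerivWithinAt2_nonneg (convex_Ici 1) (continuousOn_secondDiff h0)
    (f' := fun x => (α + 1) * ((x + 1) ^ α - 2 * x ^ α + (x - 1) ^ α))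
    (f'' := fun x => (α + 1) * (α * ((x + 1) ^ (α - 1) - 2 * x ^ (α - 1) + (x - 1) ^ (α - 1))))
    ?_ ?_ ?_
  · intro x hx
    rw [interior_Ici] at hx
    exact (hasDerivAt_secondDiff α hx).hasDerivWithinAt
  · intro x hx
    rw [interior_Ici] at hx
    have hx' : 1 < x := hx
    have h1 := ((hasDerivAt_id x).add_const 1).rpow_const (p := α)
      (Or.inl (by simp only [id]; linarith))
    have h2 := (hasDerivAt_id x).rpow_const (p := α) (Or.inl (by simp only [id]; linarith))
    have h3 := ((hasDerivAt_id x).sub_const 1).rpow_const (p := α)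
      (Or.inl (by simp only [id]; linarith))
    refine ((((h1.sub (h2.const_mul 2)).add h3).const_mul (α + 1)).congr_deriv ?_).hasDerivWithinAt
    simp only [id]
    ring
  · intro x hx
    rw [interior_Ici] at hx
    have := two_mul_rpow_le_of_nonpos (q := α - 1) (by linarith) hx
    exact mul_nonneg (by linarith) (mul_nonneg h0.le (by linarith))

/-- The derivative is a positive multiple of the second difference of the concave function `x ^ α`.
-/
lemma antitoneOn_secondDiff {α : ℝ} (h0 : 0 < α) (h1 : α < 1) :
    AntitoneOn (secondDiff α) (Ici 1) := by
  refine antitoneOn_of_deriv_nonpos (convex_Ici 1) (continuousOn_secondDiff h0) ?_ ?_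
  · intro x hx
    rw [interior_Ici] at hx
    exact (hasDerivAt_secondDiff α hx).differentiableAt.differentiableWithinAt
  · intro x hx
    rw [interior_Ici] at hx
    have hx' : 1 < x := hx
    rw [(hasDerivAt_secondDiff α hx).deriv]
    have := (Real.concaveOn_rpow h0.le h1.le).2 (show x + 1 ∈ Ici 0 by simp only [mem_Ici]; linarith)
      (show x - 1 ∈ Ici 0 by simp only [mem_Ici]; linarith)
      (by norm_num : (0 : ℝ) ≤ 1 / 2) (by norm_num : (0 : ℝ) ≤ 1 / 2) (by norm_num)
    simp only [smul_eq_mul] at this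
    rw [show 1 / 2 * (x + 1) + 1 / 2 * (x - 1) = x by ring] at this
    exact mul_nonpos_of_nonneg_of_nonpos (by linarith) (by linarith)

lemma secondDiff_nonneg {α x : ℝ} (h0 : 0 < α) (hx : 1 ≤ x) : 0 ≤ secondDiff α x := by
  have := (convexOn_rpow (p := α + 1) (by linarith)).2 (show x + 1 ∈ Ici 0 by simp only [mem_Ici]; linarith)
    (show x - 1 ∈ Ici 0 by simp only [mem_Ici]; linarith)
    (by norm_num : (0 : ℝ) ≤ 1 / 2) (by norm_num : (0 : ℝ) ≤ 1 / 2) (by norm_num)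
  simp only [smul_eq_mul] at this
  rw [show 1 / 2 * (x + 1) + 1 / 2 * (x - 1) = x by ring] at this
  unfold secondDiff
  linarith

lemma unitWeight_succ (α : ℝ) (j : ℕ) : unitWeight α (j + 1) = secondDiff α ((j : ℝ) + 1) := by
  simp [unitWeight, secondDiff]

lemma unitWeight_nonneg {α : ℝ} (h0 : 0 < α) (j : ℕ) : 0 ≤ unitWeight α j := by
  cases j with
  | zero => simp [unitWeight]
  | succ j =>
    rw [unitWeight_succ]
    exact secondDiff_nonneg h0 (by linarith [Nat.cast_nonneg (α := ℝ) j])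

/-- This is convexity of the weights at the doubled diagonal, written out. Equality holds at `α =
1`. In terms of `z = 2 ^ (α - 1)`, the tangent at `z = 1` dictates the exponent `16 / 9`, and `3 ^ 9
≤ 2 ^ 16` allows it; Bernoulli's inequality concludes. -/
lemma four_mul_two_rpow_le {α : ℝ} (h1 : α < 1) :
    4 * (2 : ℝ) ^ (α + 1) ≤ 3 ^ (α + 1) + 7 := by
  have e2 : (2 : ℝ) ^ (α + 1) = 4 * 2 ^ (α - 1) := by
    rw [show α + 1 = (α - 1) + 2 by ring, Real.rpow_add (by norm_num)]; norm_num; ring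
  have e3 : (3 : ℝ) ^ (α + 1) = 9 * 3 ^ (α - 1) := by
    rw [show α + 1 = (α - 1) + 2 by ring, Real.rpow_add (by norm_num)]; norm_num; ring
  set z := (2 : ℝ) ^ (α - 1) with hz
  have hz0 : 0 < z := Real.rpow_pos_of_pos (by norm_num) _
  have h3 : (3 : ℝ) ≤ 2 ^ ((16 : ℝ) / 9) := by
    rw [← Real.rpow_le_rpow_iff (by norm_num) (by positivity) (by norm_num : (0 : ℝ) < 9),
      ← Real.rpow_mul (by norm_num)]
    norm_num
  have hp : z ^ ((16 : ℝ) / 9) ≤ 3 ^ (α - 1) := by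
    rw [hz, ← Real.rpow_mul (by norm_num), mul_comm, Real.rpow_mul (by norm_num)]
    exact Real.rpow_le_rpow_of_nonpos (by norm_num) h3 (by linarith)
  have hb := one_add_mul_self_le_rpow_one_add (s := z - 1) (by linarith) (p := 16 / 9) (by norm_num)
  rw [show 1 + (z - 1) = z by ring] at hb
  rw [e2, e3]
  linarith

lemma unitWeight_convex {α : ℝ} (h0 : 0 < α) (h1 : α < 1) (j : ℕ) :
    0 ≤ unitWeight α (j + 1) - 2 * unitWeight α (j + 2) + unitWeight α (j + 3) := by
  have := (convexOn_secondDiff h0 h1).2 (show (j : ℝ) + 1 ∈ Ici 1 by simp)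
    (show (j : ℝ) + 3 ∈ Ici 1 by simp only [mem_Ici]; linarith [Nat.cast_nonneg (α := ℝ) j])
    (by norm_num : (0 : ℝ) ≤ 1 / 2) (by norm_num : (0 : ℝ) ≤ 1 / 2) (by norm_num)
  simp only [smul_eq_mul] at this
  rw [show 1 / 2 * ((j : ℝ) + 1) + 1 / 2 * (j + 3) = j + 2 by ring] at this
  rw [unitWeight_succ, unitWeight_succ, unitWeight_succ]
  push_cast
  rw [show (j : ℝ) + 1 + 1 = j + 2 by ring, show (j : ℝ) + 2 + 1 = j + 3 by ring]
  linarith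

lemma unitWeight_antitone {α : ℝ} (h0 : 0 < α) (h1 : α < 1) (j : ℕ) :
    unitWeight α (j + 2) ≤ unitWeight α (j + 1) := by
  rw [unitWeight_succ, unitWeight_succ]
  push_cast
  exact antitoneOn_secondDiff h0 h1 (by simp)
    (by simp only [mem_Ici]; linarith [Nat.cast_nonneg (α := ℝ) j]) (by linarith)

lemma unitWeight_convex_zero {α : ℝ} (h0 : 0 < α) (h1 : α < 1) :
    0 ≤ 2 * unitWeight α 0 - 2 * unitWeight α 1 + unitWeight α 2 := by
  have := four_mul_two_rpow_le h1
  rw [unitWeight_succ, unitWeight_succ]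
  simp only [unitWeight, secondDiff]
  norm_num [Real.zero_rpow (by linarith : α + 1 ≠ 0)]
  linarith

/-- Positivity of the causal convolution form of the weights. -/
lemma unitWeight_form_nonneg {α : ℝ} (h0 : 0 < α) (h1 : α < 1) {G : ℕ → ℕ → ℝ}
    (hsymm : ∀ n p, G n p = G p n) (hG : ∀ s : Finset ℕ, 0 ≤ ∑ n ∈ s, ∑ p ∈ s, G n p) (N : ℕ) :
    0 ≤ ∑ n ∈ Finset.range N, ∑ p ∈ Finset.range (n + 1), unitWeight α (n - p) * G n p := by
  have h := two_mul_causal_form hsymm (unitWeight α) N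
  have hnn := toeplitz_form_nonneg hG
    (c := fun j => if j = 0 then 2 * unitWeight α 0 else unitWeight α j) ?_ ?_ ?_ N
  · linarith
  · intro j
    have := unitWeight_nonneg h0 j
    have := unitWeight_nonneg h0 0
    split_ifs <;> linarith
  · intro j
    rcases j with _ | j
    -- Convexity at the diagonal and `w₂ ≤ w₁` give `2 w₀ ≥ 2 w₁ - w₂ ≥ w₁`.
    · have a1 := unitWeight_convex_zero h0 h1
      have a2 := unitWeight_antitone h0 h1 0
      simp only [zero_add, one_ne_zero, if_true, if_false]
      simp only [zero_add] at a2
      linarith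
    · simpa using unitWeight_antitone h0 h1 j
  · intro j
    rcases j with _ | j
    · simpa using unitWeight_convex_zero h0 h1
    · simpa using unitWeight_convex h0 h1 j

/-! ### Operator-theoretic preliminaries -/

section Operator

variable {H : Type*} [NormedAddCommGroup H] [InnerProductSpace ℝ H]

lemma IsSelfAdjointPosDef.inner_symm [CompleteSpace H] {A : H →ₗ.[ℝ] H}
    (hA : IsSelfAdjointPosDef A) (x y : A.domain) : ⟪A x, (y : H)⟫ = ⟪(x : H), A y⟫ := by
  have h := LinearPMap.adjoint_isFormalAdjoint hA.selfAdjoint.dense_domain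
  rw [LinearPMap.isSelfAdjoint_def.1 hA.selfAdjoint] at h
  exact h x y

lemma IsSelfAdjointPosDef.inner_nonneg [CompleteSpace H] {A : H →ₗ.[ℝ] H}
    (hA : IsSelfAdjointPosDef A) (x : A.domain) : 0 ≤ ⟪A x, (x : H)⟫ := by
  by_cases hx : (x : H) = 0
  · simp [hx]
  · exact (hA.posDef x hx).le

/-- The inequality passes to the closure and is then tested on `w` itself; dividing by `‖w‖` leaves
the alternative `w = 0`. -/
lemma norm_le_of_inner_le_of_dense {S : Set H} (hS : Dense S) {w : H} {K : ℝ}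
    (h : ∀ v ∈ S, ⟪w, v⟫ ≤ K * ‖v‖) : ‖w‖ ≤ K ∨ w = 0 := by
  have hcl : IsClosed {v : H | ⟪w, v⟫ ≤ K * ‖v‖} :=
    isClosed_le (by fun_prop) (by fun_prop)
  have hw : w ∈ {v : H | ⟪w, v⟫ ≤ K * ‖v‖} :=
    hcl.closure_subset_iff.2 h (hS w)
  have hw' : ‖w‖ * ‖w‖ ≤ K * ‖w‖ := by
    rw [← real_inner_self_eq_norm_mul_norm]; exact hw
  by_cases h0 : w = 0
  · exact Or.inr h0
  · exact Or.inl (le_of_mul_le_mul_right hw' (norm_pos_iff.2 h0))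

/-- The regularity bound makes `A u` Lipschitz, in spite of `A` being unbounded. -/
lemma norm_apply_sub_le [CompleteSpace H] {A : H →ₗ.[ℝ] H} (hA : IsSelfAdjointPosDef A)
    {α M : ℝ} (hα : 0 < α) (hM : 0 ≤ M) {u : ℝ → A.domain}
    (hcont : ContinuousOn (fun t => (u t : H)) (Ici 0)) (hreg : RegularityBound A α M u)
    {s t : ℝ} (hs : 0 ≤ s) (hst : s ≤ t) :
    ‖A (u t) - A (u s)‖ ≤ M * t ^ α * (t - s) := by
  rcases hst.eq_or_lt with rfl | hst
  · simp
  obtain ⟨ut, utt, h⟩ := hreg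
  have hK : 0 ≤ M * t ^ α * (t - s) :=
    mul_nonneg (mul_nonneg hM (Real.rpow_nonneg (hs.trans hst.le) _)) (by linarith)
  -- `A` cannot be exchanged with the derivative directly. Paired with `v` in the domain it moves to
  -- `v` by symmetry, and the mean value theorem applies to the scalar function `⟪u r, A v⟫`.
  have key : ∀ v ∈ (A.domain : Set H), ⟪A (u t) - A (u s), v⟫ ≤ M * t ^ α * (t - s) * ‖v‖ := by
    intro v hv
    lift v to A.domain using hv
    obtain ⟨τ, hτ, hslope⟩ := exists_hasDerivAt_eq_slope (fun r => ⟪(u r : H), A v⟫)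
      (fun r => ⟪(ut r : H), A v⟫) hst
      ((hcont.mono fun r hr => hs.trans hr.1).inner continuousOn_const)
      (fun r hr => by
        simpa using (h r (hs.trans_lt hr.1)).1.inner ℝ (hasDerivAt_const r (A v)))
    have hτ0 : 0 < τ := hs.trans_lt hτ.1
    have hb := (h τ hτ0).2.2
    have hut : ‖A (ut τ)‖ ≤ M * t ^ α := by
      have h1 : τ * ‖A (ut τ)‖ ≤ τ * (M * τ ^ α) := by
        rw [Real.rpow_add_one hτ0.ne'] at hb
        have : 0 ≤ τ ^ 2 * ‖A (utt τ)‖ := by positivity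
        linarith
      have h2 := le_of_mul_le_mul_left h1 hτ0
      have h3 : τ ^ α ≤ t ^ α := Real.rpow_le_rpow hτ0.le hτ.2.le hα.le
      exact h2.trans (mul_le_mul_of_nonneg_left h3 hM)
    rw [eq_div_iff (by linarith), ← hA.inner_symm, ← hA.inner_symm, ← hA.inner_symm] at hslope
    rw [inner_sub_left, ← hslope]
    calc ⟪A (ut τ), (v : H)⟫ * (t - s) ≤ (M * t ^ α * ‖(v : H)‖) * (t - s) := by
          refine mul_le_mul_of_nonneg_right ?_ (by linarith)
          exact (real_inner_le_norm _ _).trans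
            (mul_le_mul_of_nonneg_right hut (norm_nonneg _))
      _ = _ := by ring
  rcases norm_le_of_inner_le_of_dense hA.selfAdjoint.dense_domain key with h | h
  · exact h
  · rw [h, norm_zero]; exact hK

end Operator

/-! ### The Abel convolution -/

section AbelConvolution

variable {E : Type*} [NormedAddCommGroup E] [NormedSpace ℝ E]

/-- Convolution with the Abel kernel. -/
noncomputable def abelConv (α : ℝ) (φ : ℝ → E) (t : ℝ) : E :=
  ∫ s in (0 : ℝ)..t, abelKernel α (t - s) • φ s

lemma abelKernel_nonneg {α t : ℝ} (hα : 0 < α) (ht : 0 ≤ t) : 0 ≤ abelKernel α t :=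
  div_nonneg (Real.rpow_nonneg ht _) (Real.Gamma_pos_of_pos hα).le

lemma intervalIntegrable_abelKernel {α : ℝ} (hα : 0 < α) (t : ℝ) :
    IntervalIntegrable (fun s => abelKernel α (t - s)) volume 0 t := by
  have h : IntervalIntegrable (abelKernel α) volume 0 t :=
    (intervalIntegral.intervalIntegrable_rpow' (by linarith)).div_const _
  simpa using (h.comp_sub_left t).symm

lemma integral_abelKernel {α : ℝ} (hα : 0 < α) (t : ℝ) :
    ∫ s in (0 : ℝ)..t, abelKernel α (t - s) = t ^ α / Real.Gamma (α + 1) := by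
  rw [intervalIntegral.integral_comp_sub_left (abelKernel α) t]
  unfold abelKernel
  rw [intervalIntegral.integral_div, integral_rpow (Or.inl (by linarith)),
    Real.Gamma_add_one hα.ne']
  simp [Real.zero_rpow hα.ne', div_div]

/-- The kernel is nonnegative with mass `t ^ α / Γ(α + 1)`, so freezing `φ` at `ψ` costs the mass
times the deviation. -/
lemma norm_abelConv_sub_le [CompleteSpace E] {α t D : ℝ} (hα : 0 < α) (ht : 0 ≤ t) {φ : ℝ → E}
    {ψ : E} (hφ : IntervalIntegrable (fun s => abelKernel α (t - s) • φ s) volume 0 t)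
    (hD : ∀ s ∈ Icc 0 t, ‖φ s - ψ‖ ≤ D) :
    ‖abelConv α φ t - (t ^ α / Real.Gamma (α + 1)) • ψ‖ ≤ t ^ α / Real.Gamma (α + 1) * D := by
  have hk := intervalIntegrable_abelKernel hα t
  rw [← integral_abelKernel hα, ← intervalIntegral.integral_smul_const, abelConv,
    ← intervalIntegral.integral_sub hφ ⟨hk.1.smul_const ψ, hk.2.smul_const ψ⟩,
    ← intervalIntegral.integral_mul_const]
  refine intervalIntegral.norm_integral_le_of_norm_le ht ?_ (hk.mul_const D)
  refine Filter.Eventually.of_forall fun s hs => ?_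
  have h0 := abelKernel_nonneg (α := α) hα (sub_nonneg.2 hs.2)
  rw [← smul_sub, norm_smul, Real.norm_of_nonneg h0]
  exact mul_le_mul_of_nonneg_left (hD s ⟨hs.1.le, hs.2⟩) h0

/-- Rescaling leaves `t` only in a prefactor and in the argument of `φ`, so that dominated
convergence yields continuity in `t`. -/
lemma abelConv_eq_integral_unit {α t : ℝ} (hα : 0 < α) (ht : 0 ≤ t) (φ : ℝ → E) :
    abelConv α φ t = t ^ α • ∫ x in (0 : ℝ)..1, abelKernel α (1 - x) • φ (t * x) := by
  rcases ht.eq_or_lt with rfl | ht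
  · simp [abelConv, Real.zero_rpow hα.ne']
  have h := intervalIntegral.smul_integral_comp_mul_left (a := 0) (b := 1)
    (fun s => abelKernel α (t - s) • φ s) t
  rw [mul_zero, mul_one] at h
  rw [abelConv, ← h, ← intervalIntegral.integral_smul, ← intervalIntegral.integral_smul]
  refine intervalIntegral.integral_congr fun x hx => ?_
  rw [uIcc_of_le zero_le_one] at hx
  simp only [smul_smul]
  congr 1
  unfold abelKernel
  rw [show t - t * x = t * (1 - x) by ring, Real.mul_rpow ht.le (by linarith [hx.2]),
    Real.rpow_sub_one ht.ne']
  field_simp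

lemma continuousOn_abelConv {α b : ℝ} (hα : 0 < α) (hb : 0 ≤ b) {φ : ℝ → E}
    (hφ : ContinuousOn φ (Icc 0 b)) : ContinuousOn (abelConv α φ) (Icc 0 b) := by
  obtain ⟨K, hK⟩ := isCompact_Icc.exists_bound_of_continuousOn hφ
  -- Clamping the argument to `[0, b]` makes `φ` continuous and bounded on the whole line.
  set g : ℝ → E := fun t => φ (projIcc 0 b hb t) with hg
  have hgc : Continuous g :=
    hφ.comp_continuous (continuous_subtype_val.comp continuous_projIcc)
      fun t => (projIcc 0 b hb t).2
  have hk : IntervalIntegrable (fun x => abelKernel α (1 - x)) volume 0 1 :=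
    intervalIntegrable_abelKernel hα 1
  have hcont : Continuous fun t : ℝ =>
      ∫ x in (0 : ℝ)..1, abelKernel α (1 - x) • g (t * x) := by
    refine intervalIntegral.continuous_of_dominated_interval
      (bound := fun x => abelKernel α (1 - x) * K) ?_ ?_ (hk.mul_const K) ?_
    · intro t
      have hgt : Continuous fun x => g (t * x) := by fun_prop
      exact hk.def'.aestronglyMeasurable.smul hgt.aestronglyMeasurable
    · refine fun t => Filter.Eventually.of_forall fun x hx => ?_
      rw [uIoc_of_le zero_le_one] at hx
      have h0 := abelKernel_nonneg (α := α) hα (sub_nonneg.2 hx.2)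
      rw [norm_smul, Real.norm_of_nonneg h0]
      exact mul_le_mul_of_nonneg_left (hK _ (projIcc 0 b hb _).2) h0
    · exact Filter.Eventually.of_forall fun x _ => by fun_prop
  have hpow : Continuous fun t : ℝ => t ^ α := Real.continuous_rpow_const hα.le
  refine (hpow.smul hcont).continuousOn.congr fun t ht => ?_
  rw [abelConv_eq_integral_unit hα ht.1]
  congr 1
  refine intervalIntegral.integral_congr fun x hx => ?_
  rw [uIcc_of_le zero_le_one] at hx
  simp only [hg]
  rw [projIcc_of_mem hb (x := t * x)
    ⟨mul_nonneg ht.1 hx.1, (mul_le_of_le_one_right ht.1 hx.2).trans ht.2⟩]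

end AbelConvolution

/-! ### Consistency of the scheme -/

section Consistency

variable {H : Type*} [NormedAddCommGroup H] [InnerProductSpace ℝ H]

lemma halfStep_succ (φ : ℕ → H) (m : ℕ) :
    halfStep φ (m + 1) = (1 / 2 : ℝ) • (φ (m + 1) + φ m) := rfl

lemma piRule_succ (α k : ℝ) (φ : ℕ → H) (m : ℕ) :
    piRule α k φ (m + 1) = (piWeight α k m / 2) • (φ 1 - φ 0) +
      ∑ p ∈ Finset.range (m + 1), piWeight α k (m - p) • halfStep φ (p + 1) := by
  unfold piRule
  congr 1
  have : Finset.Icc 1 (m + 1) = Finset.Ico 1 (m + 2) := by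
    ext i; simp only [Finset.mem_Icc, Finset.mem_Ico]; omega
  rw [this, Finset.sum_Ico_eq_sum_range]
  refine Finset.sum_congr rfl fun i hi => ?_
  rw [add_comm 1 i, Nat.add_sub_add_right]

lemma piWeight_nonneg {α k : ℝ} (hα : 0 < α) (hk : 0 < k) (j : ℕ) : 0 ≤ piWeight α k j := by
  rw [piWeight_eq hk]
  exact mul_nonneg (div_nonneg (Real.rpow_nonneg hk.le _)
    (Real.Gamma_pos_of_pos (by linarith)).le) (unitWeight_nonneg hα j)

lemma sum_piWeight {α k : ℝ} (hα : 0 < α) (hk : 0 < k) (m : ℕ) :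
    ∑ p ∈ Finset.range (m + 1), piWeight α k (m - p) =
      k ^ α / Real.Gamma (α + 2) * (((m : ℝ) + 1) ^ (α + 1) - (m : ℝ) ^ (α + 1)) := by
  have h := Finset.sum_range_reflect (piWeight α k) (m + 1)
  simp only [Nat.add_sub_cancel] at h
  rw [h, ← sum_unitWeight hα, Finset.mul_sum]
  exact Finset.sum_congr rfl fun j _ => piWeight_eq hk j

lemma sum_piWeight_le {α k : ℝ} (hα : 0 < α) (hα1 : α < 1) (hk : 0 < k)
    (hkG : k ^ α ≤ Real.Gamma (α + 2)) (m : ℕ) :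
    ∑ p ∈ Finset.range (m + 1), piWeight α k (m - p) ≤ ((m : ℝ) + 1) ^ 2 := by
  have hG : 0 < Real.Gamma (α + 2) := Real.Gamma_pos_of_pos (by linarith)
  have h1 : k ^ α / Real.Gamma (α + 2) ≤ 1 := (div_le_one hG).2 hkG
  have hm : (0 : ℝ) ≤ m := Nat.cast_nonneg m
  have h2 : ((m : ℝ) + 1) ^ (α + 1) ≤ ((m : ℝ) + 1) ^ 2 := by
    rw [← Real.rpow_natCast]
    exact Real.rpow_le_rpow_of_exponent_le (by linarith) (by push_cast; linarith)
  have h3 : 0 ≤ (m : ℝ) ^ (α + 1) := Real.rpow_nonneg hm _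
  have h4 : (m : ℝ) ^ (α + 1) ≤ ((m : ℝ) + 1) ^ (α + 1) :=
    Real.rpow_le_rpow hm (by linarith) (by linarith)
  rw [sum_piWeight hα hk]
  calc _ ≤ 1 * (((m : ℝ) + 1) ^ (α + 1) - (m : ℝ) ^ (α + 1)) :=
        mul_le_mul_of_nonneg_right h1 (by linarith)
    _ ≤ _ := by linarith

lemma piWeight_le {α k : ℝ} (hα : 0 < α) (hα1 : α < 1) (hk : 0 < k)
    (hkG : k ^ α ≤ Real.Gamma (α + 2)) (m : ℕ) : piWeight α k m ≤ ((m : ℝ) + 1) ^ 2 := by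
  refine le_trans ?_ (sum_piWeight_le hα hα1 hk hkG m)
  have := Finset.single_le_sum (f := fun p => piWeight α k (m - p))
    (fun p _ => piWeight_nonneg hα hk (m - p)) (Finset.mem_range.2 (Nat.succ_pos m))
  simpa using this

/-- Exactness on constants: `t ^ α / Γ(α + 1)` is the Abel convolution of the constant `1`. -/
lemma integral_rpow_div_Gamma {α k : ℝ} (hα : 0 < α) (hk : 0 < k) (m : ℕ) :
    ∫ t in ((m : ℝ) * k)..(((m : ℝ) + 1) * k), t ^ α / Real.Gamma (α + 1) =
      k * ∑ p ∈ Finset.range (m + 1), piWeight α k (m - p) := by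
  have hm : (0 : ℝ) ≤ m := Nat.cast_nonneg m
  have hG : Real.Gamma (α + 2) = (α + 1) * Real.Gamma (α + 1) := by
    rw [show α + 2 = (α + 1) + 1 by ring, Real.Gamma_add_one (by linarith)]
  have hG0 : 0 < Real.Gamma (α + 1) := Real.Gamma_pos_of_pos (by linarith)
  rw [sum_piWeight hα hk, intervalIntegral.integral_div, integral_rpow (Or.inl (by linarith)),
    Real.mul_rpow hm hk.le, Real.mul_rpow (by linarith) hk.le, Real.rpow_add_one hk.ne', hG]
  field_simp

/-- The rule is exact on constants up to the oscillation of the argument. -/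
lemma norm_piRule_sub_le {α k D : ℝ} (hα : 0 < α) (hk : 0 < k) (φ : ℕ → H) (ψ : H) (m : ℕ)
    (h01 : ‖φ 1 - φ 0‖ ≤ D) (hD : ∀ p ≤ m + 1, ‖φ p - ψ‖ ≤ D) :
    ‖piRule α k φ (m + 1) - (∑ p ∈ Finset.range (m + 1), piWeight α k (m - p)) • ψ‖ ≤
      (piWeight α k m / 2 + ∑ p ∈ Finset.range (m + 1), piWeight α k (m - p)) * D := by
  have hw := piWeight_nonneg (α := α) (k := k) hα hk
  have hhalf : ∀ p < m + 1, ‖halfStep φ (p + 1) - ψ‖ ≤ D := by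
    intro p hp
    have e : halfStep φ (p + 1) - ψ = (1 / 2 : ℝ) • ((φ (p + 1) - ψ) + (φ p - ψ)) := by
      rw [halfStep_succ]; module
    rw [e, norm_smul]
    have := norm_add_le (φ (p + 1) - ψ) (φ p - ψ)
    have := hD (p + 1) (by omega)
    have := hD p (by omega)
    norm_num
    linarith
  rw [piRule_succ, Finset.sum_smul, add_sub_assoc, ← Finset.sum_sub_distrib, add_mul,
    Finset.sum_mul]
  refine (norm_add_le _ _).trans (add_le_add ?_ ((norm_sum_le _ _).trans ?_))
  · rw [norm_smul, Real.norm_of_nonneg (by linarith [hw m])]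
    exact mul_le_mul_of_nonneg_left h01 (by linarith [hw m])
  · refine Finset.sum_le_sum fun p hp => ?_
    rw [← smul_sub, norm_smul, Real.norm_of_nonneg (hw _)]
    exact mul_le_mul_of_nonneg_left (hhalf p (Finset.mem_range.1 hp)) (hw _)

/-- Defect of a function `φ` with `‖φ'‖ ≤ M t ^ α` under the discretisation of
`φ + β * φ` averaged over a step. -/
lemma norm_defect_le [CompleteSpace H] {α M k : ℝ} (hα : 0 < α) (hα1 : α < 1) (hM : 0 ≤ M)
    (hk : 0 < k) (hkG : k ^ α ≤ Real.Gamma (α + 2)) {φ : ℝ → H}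
    (hlip : ∀ s t : ℝ, 0 ≤ s → s ≤ t → ‖φ t - φ s‖ ≤ M * t ^ α * (t - s))
    (hφ : ContinuousOn φ (Ici 0))
    (hint : ∀ t : ℝ, 0 < t →
      IntervalIntegrable (fun s => abelKernel α (t - s) • φ s) volume 0 t) (m : ℕ) :
    ‖k • halfStep (fun i : ℕ => φ (i * k)) (m + 1) + k • piRule α k (fun i : ℕ => φ (i * k)) (m + 1)
      - ∫ t in ((m : ℝ) * k)..(((m : ℝ) + 1) * k), (φ t + abelConv α φ t)‖ ≤
      6 * Real.Gamma (α + 2) * M * k ^ 2 * ((m : ℝ) + 1) ^ 4 := by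
  have hm : (0 : ℝ) ≤ m := Nat.cast_nonneg m
  set n : ℝ := (m : ℝ) + 1 with hn
  have hn1 : 1 ≤ n := by linarith
  set T : ℝ := n * k with hT
  have hT0 : 0 < T := by positivity
  have hmT : (m : ℝ) * k ≤ T := mul_le_mul_of_nonneg_right (by linarith) hk.le
  have hmk : 0 ≤ (m : ℝ) * k := by positivity
  have hlen : T - m * k = k := by rw [hT, hn]; ring
  set ψ := φ T with hψ
  -- `D` bounds the distance of `φ` from its final value `ψ` over all of `[0, T]`.
  set D : ℝ := M * T ^ α * T with hDdef
  have hD0 : 0 ≤ D := by positivity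
  have hD : ∀ s ∈ Icc 0 T, ‖φ s - ψ‖ ≤ D := by
    intro s hs
    rw [norm_sub_rev]
    refine (hlip s T hs.1 hs.2).trans (mul_le_mul_of_nonneg_left (by linarith [hs.1]) ?_)
    positivity
  have hgrid : ∀ p ≤ m + 1, ((p : ℝ) * k) ∈ Icc 0 T := by
    intro p hp
    have : (p : ℝ) ≤ n := by rw [hn]; exact_mod_cast hp
    exact ⟨by positivity, mul_le_mul_of_nonneg_right this hk.le⟩
  have h01 : ‖φ ((1 : ℕ) * k) - φ ((0 : ℕ) * k)‖ ≤ D := by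
    have hkT : k ≤ T := by rw [hT]; nlinarith
    have h := hlip 0 k le_rfl hk.le
    have h2 : k ^ α ≤ T ^ α := Real.rpow_le_rpow hk.le hkT hα.le
    simp only [Nat.cast_one, one_mul, Nat.cast_zero, zero_mul]
    refine h.trans ?_
    rw [sub_zero, hDdef]
    gcongr
  set W : ℝ := ∑ p ∈ Finset.range (m + 1), piWeight α k (m - p) with hW
  have hW2 : W ≤ n ^ 2 := sum_piWeight_le hα hα1 hk hkG m
  have hw2 : piWeight α k m ≤ n ^ 2 := piWeight_le hα hα1 hk hkG m
  have hG0 : 0 < Real.Gamma (α + 1) := Real.Gamma_pos_of_pos (by linarith)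
  have hG : Real.Gamma (α + 2) = (α + 1) * Real.Gamma (α + 1) := by
    rw [show α + 2 = (α + 1) + 1 by ring, Real.Gamma_add_one (by linarith)]
  have hnα : n ^ α ≤ n := by
    simpa using Real.rpow_le_rpow_of_exponent_le hn1 hα1.le
  have hTα : T ^ α ≤ n * Real.Gamma (α + 2) := by
    rw [hT, Real.mul_rpow (by linarith) hk.le]
    exact mul_le_mul hnα hkG (Real.rpow_nonneg hk.le _) (by linarith)
  have hκ : T ^ α / Real.Gamma (α + 1) ≤ 2 * n := by
    rw [div_le_iff₀ hG0]
    refine hTα.trans ?_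
    rw [hG]
    nlinarith [mul_pos (lt_of_lt_of_le one_pos hn1) hG0]
  have b1 : ‖halfStep (fun i : ℕ => φ (i * k)) (m + 1) - ψ‖ ≤ D := by
    have e : halfStep (fun i : ℕ => φ (i * k)) (m + 1) - ψ = (1 / 2 : ℝ) • (φ (m * k) - ψ) := by
      rw [halfStep_succ]
      simp only [Nat.cast_add, Nat.cast_one, ← hn, ← hT, ← hψ]
      module
    rw [e, norm_smul]
    have := hD _ (hgrid m (by omega))
    norm_num
    linarith
  have b3 : ‖piRule α k (fun i : ℕ => φ (i * k)) (m + 1) - W • ψ‖ ≤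
      (piWeight α k m / 2 + W) * D :=
    norm_piRule_sub_le hα hk (fun i : ℕ => φ (i * k)) ψ m h01 fun p hp => hD _ (hgrid p hp)
  have hsub : uIcc ((m : ℝ) * k) T ⊆ Icc 0 T := by
    rw [uIcc_of_le hmT]; exact Icc_subset_Icc_left hmk
  have hφi : IntervalIntegrable φ volume (m * k) T :=
    (hφ.mono fun t ht => (hsub ht).1).intervalIntegrable
  have hci : IntervalIntegrable (abelConv α φ) volume (m * k) T :=
    ((continuousOn_abelConv hα hT0.le (hφ.mono Icc_subset_Ici_self)).mono hsub).intervalIntegrable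
  have b2 : ‖(∫ t in ((m : ℝ) * k)..T, φ t) - k • ψ‖ ≤ D * k := by
    have e : k • ψ = ∫ t in ((m : ℝ) * k)..T, ψ := by
      rw [intervalIntegral.integral_const, hlen]
    rw [e, ← intervalIntegral.integral_sub hφi intervalIntegrable_const]
    refine (intervalIntegral.norm_integral_le_of_norm_le_const fun t ht => ?_).trans
      (by rw [hlen, abs_of_pos hk])
    exact hD t (hsub (uIoc_subset_uIcc ht))
  have b4 : ‖(∫ t in ((m : ℝ) * k)..T, abelConv α φ t) - (k * W) • ψ‖ ≤ 2 * n * D * k := by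
    have hpi : IntervalIntegrable (fun t : ℝ => t ^ α / Real.Gamma (α + 1)) volume (m * k) T :=
      (intervalIntegral.intervalIntegrable_rpow' (by linarith)).div_const _
    rw [hW, ← integral_rpow_div_Gamma hα hk m, ← hn, ← hT,
      ← intervalIntegral.integral_smul_const,
      ← intervalIntegral.integral_sub hci ⟨hpi.1.smul_const ψ, hpi.2.smul_const ψ⟩]
    refine (intervalIntegral.norm_integral_le_of_norm_le_const fun t ht => ?_).trans
      (by rw [hlen, abs_of_pos hk])
    rw [uIoc_of_le hmT] at ht
    have ht0 : 0 < t := hmk.trans_lt ht.1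
    refine (norm_abelConv_sub_le hα ht0.le (hint t ht0)
      fun s hs => hD s ⟨hs.1, hs.2.trans ht.2⟩).trans (mul_le_mul_of_nonneg_right ?_ hD0)
    refine le_trans ?_ hκ
    gcongr
    exact ht.2
  rw [intervalIntegral.integral_add hφi hci]
  -- The constants `k ψ` and `k W ψ` appear once on the discrete side and once on the continuous
  -- side, so they cancel and four deviations remain.
  have e : ∀ a b c d : H, k • a + k • b - (c + d) =
      k • (a - ψ) + k • (b - W • ψ) - ((c - k • ψ) + (d - (k * W) • ψ)) := by
    intro a b c d; module
  rw [e]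
  -- The source of `k²`: one factor is the step length, the other comes from `T = n k`; `T ^ α` is
  -- bounded by `n Γ(α + 2)`.
  have hDk : D * k ≤ Real.Gamma (α + 2) * M * k ^ 2 * n ^ 2 := by
    calc D * k = M * k * T * T ^ α := by rw [hDdef]; ring
      _ ≤ M * k * T * (n * Real.Gamma (α + 2)) := mul_le_mul_of_nonneg_left hTα (by positivity)
      _ = _ := by rw [hT]; ring
  have hn2 : n ≤ n ^ 2 := by nlinarith
  have hkn (x : H) : ‖k • x‖ = k * ‖x‖ := by rw [norm_smul, Real.norm_of_nonneg hk.le]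
  have hDk0 : 0 ≤ D * k := by positivity
  calc _ ≤ k * D + k * ((piWeight α k m / 2 + W) * D) + (D * k + 2 * n * D * k) := by
        refine (norm_sub_le _ _).trans (add_le_add ((norm_add_le _ _).trans ?_)
          ((norm_add_le _ _).trans (add_le_add b2 b4)))
        rw [hkn, hkn]
        exact add_le_add (mul_le_mul_of_nonneg_left b1 hk.le)
          (mul_le_mul_of_nonneg_left b3 hk.le)
    _ = (2 + piWeight α k m / 2 + W + 2 * n) * (D * k) := by ring
    _ ≤ (6 * n ^ 2) * (D * k) := by
        refine mul_le_mul_of_nonneg_right ?_ hDk0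
        nlinarith
    _ ≤ (6 * n ^ 2) * (Real.Gamma (α + 2) * M * k ^ 2 * n ^ 2) :=
        mul_le_mul_of_nonneg_left hDk (by positivity)
    _ = _ := by ring

end Consistency

/-! ### Stability of the scheme -/

section Stability

variable {H : Type*} [NormedAddCommGroup H] [InnerProductSpace ℝ H]

/-- The double sum is `⟪A v, v⟫` for `v = ∑ x p`; this supplies `hG` in the Toeplitz lemmas. -/
lemma IsSelfAdjointPosDef.sum_inner_nonneg [CompleteSpace H] {A : H →ₗ.[ℝ] H}
    (hA : IsSelfAdjointPosDef A) (x : ℕ → A.domain) (s : Finset ℕ) :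
    0 ≤ ∑ n ∈ s, ∑ p ∈ s, ⟪A (x p), (x n : H)⟫ := by
  have h := hA.inner_nonneg (∑ p ∈ s, x p)
  have e : A (∑ p ∈ s, x p) = ∑ p ∈ s, A (x p) := map_sum A.toFun x s
  rw [e, AddSubmonoidClass.coe_finsetSum, inner_sum] at h
  simpa only [sum_inner] using h

/-- A sequence whose energy increments are controlled by `‖R m‖ ‖e‖` is controlled by `∑ ‖R m‖`. -/
lemma norm_le_two_mul_sum_of_energy {E : Type*} [NormedAddCommGroup E] {e R : ℕ → E}
    (h : ∀ N, ‖e N‖ ^ 2 ≤ ∑ m ∈ Finset.range N, ‖R m‖ * (‖e (m + 1)‖ + ‖e m‖)) (N : ℕ) :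
    ‖e N‖ ≤ 2 * ∑ m ∈ Finset.range N, ‖R m‖ := by
  -- At the index of largest norm both norms in the energy increment are at most `‖e i‖`, and one
  -- factor `‖e i‖` cancels.
  obtain ⟨i, hi, hmax⟩ := Finset.exists_max_image (Finset.range (N + 1)) (fun m => ‖e m‖)
    ⟨0, by simp⟩
  have hiN : i ≤ N := Nat.lt_succ_iff.1 (Finset.mem_range.1 hi)
  refine (hmax N (by simp)).trans ?_
  have h1 : ‖e i‖ ^ 2 ≤ (2 * ∑ m ∈ Finset.range N, ‖R m‖) * ‖e i‖ := by
    refine (h i).trans ?_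
    have h2 : ∑ m ∈ Finset.range i, ‖R m‖ * (‖e (m + 1)‖ + ‖e m‖) ≤
        ∑ m ∈ Finset.range i, ‖R m‖ * (2 * ‖e i‖) := by
      refine Finset.sum_le_sum fun m hm => mul_le_mul_of_nonneg_left ?_ (norm_nonneg _)
      have hm' := Finset.mem_range.1 hm
      have := hmax (m + 1) (Finset.mem_range.2 (by omega))
      have := hmax m (Finset.mem_range.2 (by omega))
      linarith
    have h3 : ∑ m ∈ Finset.range i, ‖R m‖ * (2 * ‖e i‖) ≤
        ∑ m ∈ Finset.range N, ‖R m‖ * (2 * ‖e i‖) :=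
      Finset.sum_le_sum_of_subset_of_nonneg (Finset.range_subset_range.2 hiN)
        fun m _ _ => by positivity
    refine h2.trans (h3.trans_eq ?_)
    rw [← Finset.sum_mul]
    ring
  rcases (norm_nonneg (e i)).eq_or_lt with h0 | h0
  · rw [← h0]
    exact mul_nonneg zero_le_two (Finset.sum_nonneg fun _ _ => norm_nonneg _)
  · rw [sq] at h1
    exact le_of_mul_le_mul_right h1 h0

/-- Energy stability of the Crank–Nicolson scheme with zero initial value and forcing `R`. -/
lemma norm_le_of_scheme [CompleteSpace H] {A : H →ₗ.[ℝ] H} (hA : IsSelfAdjointPosDef A)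
    {α k : ℝ} (hα : 0 < α) (hα1 : α < 1) (hk : 0 < k) {e : ℕ → A.domain} (he0 : e 0 = 0)
    {R : ℕ → H}
    (hstep : ∀ m : ℕ, (e (m + 1) : H) - e m + k • halfStep (fun i => A (e i)) (m + 1) +
      k • ∑ p ∈ Finset.range (m + 1), piWeight α k (m - p) • halfStep (fun i => A (e i)) (p + 1)
        = R m) (N : ℕ) :
    ‖(e N : H)‖ ≤ 2 * ∑ m ∈ Finset.range N, ‖R m‖ := by
  refine norm_le_two_mul_sum_of_energy (e := fun m => (e m : H)) (fun N => ?_) N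
  set x : ℕ → A.domain := fun m => (1 / 2 : ℝ) • (e (m + 1) + e m) with hx
  have hxA : ∀ m, halfStep (fun i => A (e i)) (m + 1) = A (x m) := by
    intro m
    rw [halfStep_succ, hx]
    simp only [LinearPMap.map_smul, LinearPMap.map_add]
  -- Testing with the midpoint turns the difference quotient into a telescoping difference of
  -- squared norms.
  have htest : ∀ m, ‖(e (m + 1) : H)‖ ^ 2 - ‖(e m : H)‖ ^ 2 + 2 * k * ⟪A (x m), (x m : H)⟫ +
      2 * k * ∑ p ∈ Finset.range (m + 1), piWeight α k (m - p) * ⟪A (x p), (x m : H)⟫ =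
      2 * ⟪R m, (x m : H)⟫ := by
    intro m
    have h := hstep m
    simp_rw [hxA] at h
    rw [← h, inner_add_left, inner_add_left, inner_smul_left, inner_smul_left, sum_inner]
    simp_rw [inner_smul_left]
    have e1 : ⟪(e (m + 1) : H) - e m, (x m : H)⟫ =
        1 / 2 * (‖(e (m + 1) : H)‖ ^ 2 - ‖(e m : H)‖ ^ 2) := by
      simp only [hx, Submodule.coe_smul, Submodule.coe_add, inner_smul_right, inner_sub_left,
        inner_add_right, real_inner_self_eq_norm_sq]
      rw [real_inner_comm (e m : H) (e (m + 1) : H)]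
      ring
    rw [e1]
    simp only [conj_trivial]
    ring
  have hform : 0 ≤ ∑ m ∈ Finset.range N, ∑ p ∈ Finset.range (m + 1),
      piWeight α k (m - p) * ⟪A (x p), (x m : H)⟫ := by
    have h := unitWeight_form_nonneg hα hα1 (G := fun n p => ⟪A (x p), (x n : H)⟫)
      (fun n p => by rw [hA.inner_symm, real_inner_comm]) (hA.sum_inner_nonneg x) N
    have hc : 0 ≤ k ^ α / Real.Gamma (α + 2) :=
      div_nonneg (Real.rpow_nonneg hk.le _) (Real.Gamma_pos_of_pos (by linarith)).le
    have h2 := mul_nonneg hc h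
    simp_rw [Finset.mul_sum, ← mul_assoc, ← piWeight_eq hk] at h2
    exact h2
  have hsum := Finset.sum_congr rfl fun m (_ : m ∈ Finset.range N) => htest m
  rw [Finset.sum_add_distrib, Finset.sum_add_distrib,
    Finset.sum_range_sub (fun m => ‖(e m : H)‖ ^ 2), he0, ← Finset.mul_sum, ← Finset.mul_sum] at hsum
  have hpos : 0 ≤ ∑ m ∈ Finset.range N, ⟪A (x m), (x m : H)⟫ :=
    Finset.sum_nonneg fun m _ => hA.inner_nonneg (x m)
  have hR : ∑ m ∈ Finset.range N, 2 * ⟪R m, (x m : H)⟫ ≤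
      ∑ m ∈ Finset.range N, ‖R m‖ * (‖(e (m + 1) : H)‖ + ‖(e m : H)‖) := by
    refine Finset.sum_le_sum fun m _ => ?_
    have h1 := real_inner_le_norm (R m) (x m : H)
    have h2 : ‖(x m : H)‖ ≤ 1 / 2 * (‖(e (m + 1) : H)‖ + ‖(e m : H)‖) := by
      simp only [hx, Submodule.coe_smul, Submodule.coe_add, norm_smul]
      rw [Real.norm_of_nonneg (by norm_num)]
      exact mul_le_mul_of_nonneg_left (norm_add_le _ _) (by norm_num)
    have h3 := mul_le_mul_of_nonneg_left h2 (norm_nonneg (R m))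
    linarith
  have a1 := mul_nonneg hk.le hpos
  have a2 := mul_nonneg hk.le hform
  simp only [Submodule.coe_zero, norm_zero] at hsum
  linarith

lemma halfStep_sub (φ χ : ℕ → H) (n : ℕ) :
    halfStep (fun i => φ i - χ i) n = halfStep φ n - halfStep χ n := by
  unfold halfStep; module

lemma piRule_sub (α k : ℝ) (φ χ : ℕ → H) (n : ℕ) :
    piRule α k (fun i => φ i - χ i) n = piRule α k φ n - piRule α k χ n := by
  unfold piRule
  simp_rw [halfStep_sub, smul_sub, Finset.sum_sub_distrib]
  abel

/-- The starting correction of the rule costs no more than the forcing of the first step. -/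
lemma norm_le_of_scheme_with_correction [CompleteSpace H] {A : H →ₗ.[ℝ] H}
    (hA : IsSelfAdjointPosDef A) {α k K : ℝ} (hα : 0 < α) (hα1 : α < 1) (hk : 0 < k)
    (hkG : k ^ α ≤ Real.Gamma (α + 2)) (hK : 0 ≤ K) {e : ℕ → A.domain} (he0 : e 0 = 0)
    {ρ : ℕ → H}
    (hstep : ∀ m : ℕ, (e (m + 1) : H) - e m + k • halfStep (fun i => A (e i)) (m + 1) +
      k • piRule α k (fun i => A (e i)) (m + 1) = ρ m)
    (hρ : ∀ m : ℕ, ‖ρ m‖ ≤ K * ((m : ℝ) + 1) ^ 4) (N : ℕ) :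
    ‖(e N : H)‖ ≤ 4 * K * (N : ℝ) ^ 5 := by
  have hAe0 : A (e 0) = 0 := by rw [he0, LinearPMap.map_zero]
  have hw := piWeight_nonneg (α := α) (k := k) hα hk
  have hfirst : k / 2 * ‖A (e 1)‖ ≤ K := by
    have h0 := hstep 0
    have hρ0 := hρ 0
    set a : ℝ := k / 2 + k * piWeight α k 0 with ha
    have ha0 : 0 ≤ a := add_nonneg (by positivity) (mul_nonneg hk.le (hw 0))
    -- In the first step the correction and the rule each contribute half of `w₀`, so the step is a
    -- resolvent equation; squaring it, with the cross term nonnegative, bounds `A (e 1)`.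
    have h1 : (e 1 : H) + a • A (e 1) = ρ 0 := by
      rw [← h0, piRule_succ]
      simp only [zero_add, Finset.sum_range_one, Nat.sub_self, halfStep, he0,
        LinearPMap.map_zero, Submodule.coe_zero, sub_zero, add_zero, ha]
      module
    have h2 : ‖ρ 0‖ ^ 2 = ‖(e 1 : H)‖ ^ 2 + 2 * (a * ⟪A (e 1), (e 1 : H)⟫) +
        (a * ‖A (e 1)‖) ^ 2 := by
      rw [← h1, norm_add_sq_real, inner_smul_right, norm_smul, Real.norm_of_nonneg ha0,
        real_inner_comm]
    have h3 := mul_nonneg ha0 (hA.inner_nonneg (e 1))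
    have h4 : a * ‖A (e 1)‖ ≤ ‖ρ 0‖ :=
      abs_le_of_sq_le_sq' (by nlinarith [sq_nonneg ‖(e 1 : H)‖]) (norm_nonneg _) |>.2
    have h5 : k / 2 * ‖A (e 1)‖ ≤ a * ‖A (e 1)‖ :=
      mul_le_mul_of_nonneg_right (by linarith [mul_nonneg hk.le (hw 0)]) (norm_nonneg _)
    norm_num at hρ0
    linarith
  -- As `A (e 0) = 0`, the correction is a multiple of `A (e 1)` and joins the forcing.
  have hmain := norm_le_of_scheme hA hα hα1 hk he0
    (R := fun m => ρ m - (k * piWeight α k m / 2) • A (e 1)) (fun m => by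
      rw [← hstep m, piRule_succ, hAe0, sub_zero]; module) N
  have hR : ∀ m ∈ Finset.range N,
      ‖ρ m - (k * piWeight α k m / 2) • A (e 1)‖ ≤ 2 * K * (N : ℝ) ^ 4 := by
    intro m hm
    have hmN : (m : ℝ) + 1 ≤ N := by exact_mod_cast Finset.mem_range.1 hm
    have hm0 : (0 : ℝ) ≤ m := Nat.cast_nonneg m
    have h1 : ‖(k * piWeight α k m / 2) • A (e 1)‖ ≤ ((m : ℝ) + 1) ^ 2 * K := by
      have hwm := hw m
      rw [norm_smul, Real.norm_of_nonneg (by positivity),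
        show k * piWeight α k m / 2 * ‖A (e 1)‖ = piWeight α k m * (k / 2 * ‖A (e 1)‖) by ring]
      exact mul_le_mul (piWeight_le hα hα1 hk hkG m) hfirst (by positivity) (by positivity)
    have h2 : ((m : ℝ) + 1) ^ 2 ≤ (m + 1) ^ 4 :=
      pow_le_pow_right₀ (by linarith) (by norm_num)
    have h3 : ((m : ℝ) + 1) ^ 4 ≤ (N : ℝ) ^ 4 := pow_le_pow_left₀ (by linarith) hmN 4
    refine (norm_sub_le _ _).trans ?_
    have h4 := hρ m
    have h5 := mul_le_mul_of_nonneg_right (h2.trans h3) hK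
    have h6 := mul_le_mul_of_nonneg_left h3 hK
    linarith
  have hsum := Finset.sum_le_sum hR
  rw [Finset.sum_const, Finset.card_range, nsmul_eq_mul] at hsum
  refine hmain.trans ?_
  calc _ ≤ 2 * ((N : ℝ) * (2 * K * (N : ℝ) ^ 4)) := by linarith
    _ = _ := by ring

end Stability

/-! ### The error estimate -/

section Error

variable {H : Type*} [NormedAddCommGroup H] [InnerProductSpace ℝ H] [CompleteSpace H]

/-- The equation, integrated over one step. -/
lemma IsSolution.sub_add_integral {A : H →ₗ.[ℝ] H} {α : ℝ} (hα : 0 < α) {f : ℝ → H} {u₀ : H}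
    {u : ℝ → A.domain} (hu : IsSolution A α f u₀ u)
    (hφ : ContinuousOn (fun t => A (u t)) (Ici 0)) {a b : ℝ} (ha : 0 ≤ a) (hab : a ≤ b)
    (hf : IntervalIntegrable f volume a b) :
    ((u b : H) - u a) + ∫ t in a..b, (A (u t) + abelConv α (fun s => A (u s)) t) =
      ∫ t in a..b, f t := by
  have hb : 0 ≤ b := ha.trans hab
  have hsub : uIcc a b ⊆ Icc 0 b := by
    rw [uIcc_of_le hab]; exact Icc_subset_Icc_left ha
  have hg : IntervalIntegrable (fun t => A (u t) + abelConv α (fun s => A (u s)) t) volume a b :=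
    ContinuousOn.intervalIntegrable ((hφ.mono fun t ht => (hsub ht).1).add
      ((continuousOn_abelConv hα hb (hφ.mono Icc_subset_Ici_self)).mono hsub))
  have hder := intervalIntegral.integral_eq_sub_of_hasDerivAt_of_le hab
    (hu.continuousOn.mono fun t ht => ha.trans ht.1)
    (f' := fun t => f t - (A (u t) + abelConv α (fun s => A (u s)) t))
    (fun t ht => by
      obtain ⟨v, hv, heq⟩ := hu.equation t (ha.trans_lt ht.1)
      have : v = f t - (A (u t) + abelConv α (fun s => A (u s)) t) := by
        rw [← heq, abelConv]; abel
      rwa [← this]) (hf.sub hg)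
  rw [intervalIntegral.integral_sub hf hg] at hder
  rw [← hder, sub_add_cancel]

/-- The scheme and the integrated equation contain the same exact integral of `f`, so the error
solves the scheme with zero initial value and minus the defect as forcing. The constant is `24 = 4 *
6`, from stability and consistency. -/
lemma norm_error_le {A : H →ₗ.[ℝ] H} (hA : IsSelfAdjointPosDef A) {α M k : ℝ} (hα : 0 < α)
    (hα1 : α < 1) (hM : 0 ≤ M) (hk : 0 < k) (hkG : k ^ α ≤ Real.Gamma (α + 2)) {f : ℝ → H}
    (hf : ∀ T : ℝ, 0 < T → IntervalIntegrable f volume 0 T) {u₀ : H} {u : ℝ → A.domain}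
    (hu : IsSolution A α f u₀ u) (hreg : RegularityBound A α M u) {U : ℕ → A.domain}
    (hU : IsSchemeSolution A α k f u₀ U) (n : ℕ) :
    ‖(U n : H) - (u (n * k) : H)‖ ≤ 24 * Real.Gamma (α + 2) * M * k ^ 2 * (n : ℝ) ^ 5 := by
  have hlip : ∀ s t : ℝ, 0 ≤ s → s ≤ t → ‖A (u t) - A (u s)‖ ≤ M * t ^ α * (t - s) :=
    fun s t hs hst => norm_apply_sub_le hA hα hM hu.continuousOn hreg hs hst
  have hφ : ContinuousOn (fun t => A (u t)) (Ici 0) := by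
    intro t ht
    have ht0 : (0 : ℝ) ≤ t := ht
    have hL : ∀ s ∈ Icc 0 (t + 1), ‖A (u s) - A (u t)‖ ≤ M * (t + 1) ^ α * |s - t| := by
      intro s hs
      have hmono : ∀ r, 0 ≤ r → r ≤ t + 1 → M * r ^ α ≤ M * (t + 1) ^ α := fun r h0 h1 =>
        mul_le_mul_of_nonneg_left (Real.rpow_le_rpow h0 h1 hα.le) hM
      rcases le_total s t with h | h
      · rw [norm_sub_rev, abs_sub_comm, abs_of_nonneg (sub_nonneg.2 h)]
        exact (hlip s t hs.1 h).trans
          (mul_le_mul_of_nonneg_right (hmono t ht0 (by linarith)) (sub_nonneg.2 h))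
      · rw [abs_of_nonneg (sub_nonneg.2 h)]
        exact (hlip t s ht0 h).trans
          (mul_le_mul_of_nonneg_right (hmono s hs.1 hs.2) (sub_nonneg.2 h))
    rw [ContinuousWithinAt, tendsto_iff_norm_sub_tendsto_zero]
    refine squeeze_zero' (Filter.Eventually.of_forall fun _ => norm_nonneg _)
      (g := fun s => M * (t + 1) ^ α * |s - t|) ?_ ?_
    · filter_upwards [self_mem_nhdsWithin,
        mem_nhdsWithin_of_mem_nhds (Iio_mem_nhds (lt_add_one t))] with s h0 h1
      exact hL s ⟨h0, le_of_lt h1⟩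
    · have : Continuous fun s : ℝ => M * (t + 1) ^ α * |s - t| := by fun_prop
      have h := this.tendsto t
      simp only [sub_self, abs_zero, mul_zero] at h
      exact h.mono_left nhdsWithin_le_nhds
  set e : ℕ → A.domain := fun n => U n - u (n * k) with he
  have hAe : (fun i => A (e i)) = fun i => A (U i) - A (u (i * k)) :=
    funext fun i => LinearPMap.map_sub A _ _
  have he0 : e 0 = 0 := by
    apply Subtype.ext
    simp [he, hU.initial, hu.initial]
  have h := norm_le_of_scheme_with_correction hA hα hα1 hk hkG
    (K := 6 * Real.Gamma (α + 2) * M * k ^ 2)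
    (by have := Real.Gamma_pos_of_pos (show 0 < α + 2 by linarith); positivity) he0
    (ρ := fun m => -(k • halfStep (fun i : ℕ => A (u (i * k))) (m + 1) +
      k • piRule α k (fun i : ℕ => A (u (i * k))) (m + 1) -
      ∫ t in ((m : ℝ) * k)..(((m : ℝ) + 1) * k), (A (u t) + abelConv α (fun s => A (u s)) t)))
    (fun m => ?_) (fun m => ?_) n
  · refine le_trans (le_of_eq ?_) (h.trans_eq (by ring))
    rfl
  · have hm : (0 : ℝ) ≤ m := Nat.cast_nonneg m
    have hmk : (m : ℝ) * k ≤ ((m : ℝ) + 1) * k := mul_le_mul_of_nonneg_right (by linarith) hk.le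
    have hfi : IntervalIntegrable f volume (m * k) (((m : ℝ) + 1) * k) := by
      refine (hf (((m : ℝ) + 1) * k) (by positivity)).mono_set ?_
      rw [uIcc_of_le hmk, uIcc_of_le (by positivity)]
      exact Icc_subset_Icc_left (by positivity)
    have hsol := hu.sub_add_integral hα hφ (by positivity) hmk hfi
    have hsch := congrArg (fun v : H => k • v) (hU.step (m + 1) (by omega))
    simp only [smul_add, smul_smul, mul_one_div_cancel hk.ne', one_smul, Nat.add_sub_cancel,
      Nat.cast_add, Nat.cast_one, add_sub_cancel_right] at hsch
    rw [← hsol] at hsch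
    rw [hAe, halfStep_sub, piRule_sub]
    simp only [he, AddSubgroupClass.coe_sub, Nat.cast_add, Nat.cast_one, smul_sub]
    rw [← sub_eq_zero] at hsch ⊢
    rw [← hsch]
    abel
  · rw [norm_neg]
    exact norm_defect_le hα hα1 hM hk hkG hlip hφ hu.convolution_integrable m

end Error

end VolterraCN

/-! ### Summation against the exponential weight. -/

theorem theorem3p15 (α c : ℝ) (hα0 : 0 < α) (hα1 : α < 1) (hc : 0 < c) :
    ∃ C : ℝ, 0 < C ∧
      ∀ (H : Type*) [NormedAddCommGroup H] [InnerProductSpace ℝ H] [CompleteSpace H]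
        (A : H →ₗ.[ℝ] H) (_ : VolterraCN.IsSelfAdjointPosDef A)
        (f : ℝ → H) (_ : ∀ T : ℝ, 0 < T → IntervalIntegrable f volume 0 T)
        (u₀ : H) (u : ℝ → A.domain) (_ : VolterraCN.IsSolution A α f u₀ u)
        (M : ℝ) (_ : 0 ≤ M) (_ : VolterraCN.RegularityBound A α M u)
        (s₀ Cα : ℝ) (_ : 0 < s₀) (_ : 0 < Cα)
        (k : ℝ) (_ : 0 < k) (_ : k ^ α ≤ s₀ * Real.Gamma (α + 2) / (s₀ + Cα))
        (U : ℕ → A.domain) (_ : VolterraCN.IsSchemeSolution A α k f u₀ U),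
        Summable (fun n : ℕ => Real.exp (-c * n) * ‖(U n : H) - (u (n * k) : H)‖ ^ 2) ∧
        Real.sqrt (∑' n : ℕ, Real.exp (-c * n) * ‖(U n : H) - (u (n * k) : H)‖ ^ 2)
          ≤ C * M * k ^ 2 := by
  have hG : 0 < Real.Gamma (α + 2) := Real.Gamma_pos_of_pos (by linarith)
  have hS : Summable fun n : ℕ => (n : ℝ) ^ 10 * Real.exp (-c * n) :=
    Real.summable_pow_mul_exp_neg_nat_mul 10 hc
  set S : ℝ := ∑' n : ℕ, (n : ℝ) ^ 10 * Real.exp (-c * n) with hSdef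
  have hS0 : 0 ≤ S := tsum_nonneg fun n => by positivity
  -- `S` carries `n ^ 10`, the square of `n ^ 5`. The summand `1` makes the constant strictly
  -- positive, as only `0 ≤ S` is at hand.
  refine ⟨24 * Real.Gamma (α + 2) * Real.sqrt S + 1, by positivity, ?_⟩
  intro H _ _ _ A hA f hf u₀ u hu M hM hreg s₀ Cα hs₀ hCα k hk hkα U hU
  -- The quotient `s₀ / (s₀ + Cα)` is below `1`, so the bound on `k` is free of `s₀` and `Cα`, and
  -- so is the constant.
  have hkG : k ^ α ≤ Real.Gamma (α + 2) := by
    refine hkα.trans ?_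
    rw [div_le_iff₀ (by linarith)]
    nlinarith [mul_pos hG hCα]
  have herr := VolterraCN.norm_error_le hA hα0 hα1 hM hk hkG hf hu hreg hU
  set K : ℝ := 24 * Real.Gamma (α + 2) * M * k ^ 2 with hK
  have hK0 : 0 ≤ K := by positivity
  have hterm : ∀ n : ℕ, Real.exp (-c * n) * ‖(U n : H) - (u (n * k) : H)‖ ^ 2 ≤
      K ^ 2 * ((n : ℝ) ^ 10 * Real.exp (-c * n)) := by
    intro n
    have h := pow_le_pow_left₀ (norm_nonneg _) (herr n) 2
    calc _ ≤ Real.exp (-c * n) * (K * (n : ℝ) ^ 5) ^ 2 :=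
          mul_le_mul_of_nonneg_left h (Real.exp_pos _).le
      _ = _ := by ring
  have hsum : Summable (fun n : ℕ => Real.exp (-c * n) * ‖(U n : H) - (u (n * k) : H)‖ ^ 2) :=
    Summable.of_nonneg_of_le (fun n => by positivity) hterm (hS.mul_left (K ^ 2))
  refine ⟨hsum, ?_⟩
  have htsum := hsum.tsum_le_tsum hterm (hS.mul_left (K ^ 2))
  rw [tsum_mul_left, ← hSdef] at htsum
  calc _ ≤ Real.sqrt (K ^ 2 * S) := Real.sqrt_le_sqrt htsum
    _ = K * Real.sqrt S := by rw [Real.sqrt_mul (sq_nonneg K), Real.sqrt_sq hK0]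
    _ = 24 * Real.Gamma (α + 2) * Real.sqrt S * M * k ^ 2 := by rw [hK]; ring
    _ ≤ _ := by
        have : 0 ≤ M * k ^ 2 := by positivity
        linarith
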